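/- Let $f:\mathbb{R}\to\mathbb{R}$ be locally Lipschitz continuous with $f(0)=0$ and $uf(u)>0$ for all $u\neq 0$, and let $g:[0,\infty)\to\mathbb{R}$ be continuous with $g(t)>0$ for all $t>0$. Suppose that $f$ is regularly varying at $0$ with index $\beta>1$, that is, $\lim_{u\to0^+} f(\lambda u)/f(u)=\lambda^{\beta}$ for every $\lambda>0$, and that $g$ is regularly varying at infinity with index $-\theta$ for some $\theta>0$, that is, $\lim_{t\to\infty} g(\lambda t)/g(t)=\lambda^{-\theta}$ for every $\lambda>0$. Let $F(u)=\int_u^1 \frac{dv}{f(v)}$ for $u>0$, and let $F^{-1}$ be the inverse of the strictly decreasing function $F$ on $(0,\infty)$ (it is defined on $[0,\infty)$). Let $\xi>0$, let $x$ be the unique continuous solution on $[0,\infty)$ of $$x'(t)=-f(x(t))+g(t),\quad t>0;\qquad x(0)=\xi,$$ and suppose that $x(t)\to0$ as $t\to\infty$. Suppose finally that the limit $$L:=\lim_{t\to\infty}\frac{g(t)}{f(F^{-1}(t))}\in[0,\infty]$$ exists. (i) If $L=0$, then $\displaystyle\lim_{t\to\infty}\frac{F(x(t))}{t}=1$. (ii)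 If $0<L<\infty$, then the equation $(1-\Lambda)\Lambda^{-\beta/(\beta-1)}=L$ has exactly one solution $\Lambda_*(L)$ in $(0,1)$, and $\displaystyle\lim_{t\to\infty}\frac{F(x(t))}{t}=\Lambda_*(L)$. (iii) If $L=\infty$, then $\displaystyle\lim_{t\to\infty}\frac{f(x(t))}{g(t)}=1$. -/

import Mathlib

open Filter Topology Set

/-- `f ∈ RV_0(β)`: `f` is measurable and positive on a right neighbourhood `(0, δ)` of `0`, and
`f (lam * x) / f x → lam ^ β` as `x → 0+`, for every `lam > 0`. -/
def RegVaryingAtZero (f : ℝ → ℝ) (β : ℝ) : Prop :=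
  (∃ δ : ℝ, 0 < δ ∧ Measurable ((Ioo 0 δ).domRestrict f) ∧ ∀ x ∈ Ioo 0 δ, 0 < f x) ∧
    ∀ lam : ℝ, 0 < lam → Tendsto (fun x => f (lam * x) / f x) (𝓝[>] 0) (𝓝 (lam ^ β))

/-- `h ∈ RV_∞(α)`: `h` is measurable and positive on a neighbourhood `(T, ∞)` of infinity, and
`h (lam * t) / h t → lam ^ α` as `t → ∞`, for every `lam > 0`. -/
def RegVaryingAtTop (h : ℝ → ℝ) (α : ℝ) : Prop :=
  (∃ T : ℝ, Measurable ((Ioi T).domRestrict h) ∧ ∀ t ∈ Ioi T, 0 < h t) ∧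
    ∀ lam : ℝ, 0 < lam → Tendsto (fun t => h (lam * t) / h t) atTop (𝓝 (lam ^ α))

/-- `F(x) = ∫_x^1 du / f(u)`, meaningful for `x > 0` (with the usual orientation if `x > 1`). -/
noncomputable def odeF (f : ℝ → ℝ) (x : ℝ) : ℝ :=
  ∫ u in x..1, 1 / f u

/-- The inverse `F⁻¹` of `F : (0, ∞) → ℝ`. For `f` continuous and positive on `(0, ∞)` the function
`F` is strictly decreasing there, so that on the range of `F` this is the unique preimage; values
off that range are irrelevant. -/
noncomputable def odeFInv (f : ℝ → ℝ) : ℝ → ℝ :=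
  Function.invFunOn (odeF f) (Ioi 0)

/-- `x` is a continuous solution on `[0, ∞)` of `x'(t) = -f(x(t)) + g(t)`, `t > 0`, `x(0) = ξ`. -/
structure IsPerturbedSolution (f g : ℝ → ℝ) (ξ : ℝ) (x : ℝ → ℝ) : Prop where
  continuousOn : ContinuousOn x (Ici 0)
  initial : x 0 = ξ
  hasDerivAt : ∀ t : ℝ, 0 < t → HasDerivAt x (-f (x t) + g t) t

/-! ### Uniform convergence for regularly varying functions -/

/-! Put `z = F(x)` and `φ = f ∘ F⁻¹`. The equation becomes `z' = 1 - g / φ(z)` with `z → ∞`. With `γ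
= β / (β - 1)`, regular variation of `f` enters through one bound: `φ s ≤ K φ t` for `s ≥ a t`, `t`
large, whenever `K > a ^ (-γ)`. If `z ~ Λ t` and `g / φ → l`, then `g / φ(z) ~ l Λ ^ γ`, so `1 - Λ =
l Λ ^ γ`. This becomes rigorous by barriers: for `b > Λ`, `z' - b` is below a negative constant
wherever `z ≥ b t`, so eventually `z < b t`; slopes below `Λ` are symmetric. The case `L = 0` is `Λ
= 1`. If `L = ∞`, the same barriers give `z = o(t)`. By uniform convergence `log g` is nearly
constant on `[c t, t]`, so if `φ(z) / g` were far from 1 at `t`, `z` would change by a fixed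
multiple of `t` on that interval, which is impossible. -/

/-- Pointwise convergence makes these sets increase to `[0, 2]`. The bound 3/2 ensures that two such
sets, one shifted by at most 1, must meet inside `[0, 3]`. -/
theorem exists_volume_gt_of_tendsto {h : ℝ → ℝ}
    (hh : ∀ u, Tendsto (fun s => h (s + u) - h s) atTop (𝓝 0)) {ε : ℝ} (hε : 0 < ε)
    {r : ℕ → ℝ} (hr : Tendsto r atTop atTop) :
    ∀ᶠ n : ℕ in atTop, ENNReal.ofReal (3 / 2) < MeasureTheory.volume
      (Icc (0 : ℝ) 2 ∩ {v | ∀ m ≥ n, |h (r m + v) - h (r m)| < ε}) := by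
  set V : ℕ → Set ℝ := fun n => Icc (0 : ℝ) 2 ∩ {v | ∀ m ≥ n, |h (r m + v) - h (r m)| < ε} with hV
  have hmono : Monotone V := by
    intro n k hnk v hv
    exact ⟨hv.1, fun m hm => hv.2 m (hnk.trans hm)⟩
  have hU : ⋃ n, V n = Icc (0 : ℝ) 2 := by
    apply Subset.antisymm
    · exact iUnion_subset fun n => inter_subset_left
    · intro v hv
      have h1 := ((hh v).comp hr).abs
      rw [abs_zero] at h1
      obtain ⟨n, hn⟩ := eventually_atTop.1 (h1.eventually_lt_const hε)
      exact mem_iUnion.2 ⟨n, hv, fun m hm => hn m hm⟩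
  have ht := MeasureTheory.tendsto_measure_iUnion_atTop (μ := MeasureTheory.volume) hmono
  rw [hU, Real.volume_Icc] at ht
  refine ht.eventually_const_lt ?_
  rw [ENNReal.ofReal_lt_ofReal_iff] <;> norm_num

/-- Uniform convergence theorem in additive form. -/
theorem eventually_forall_Icc_abs_sub_lt {h : ℝ → ℝ} (hm : Measurable h)
    (hh : ∀ u, Tendsto (fun s => h (s + u) - h s) atTop (𝓝 0)) {ε : ℝ} (hε : 0 < ε) :
    ∀ᶠ s in atTop, ∀ u ∈ Icc (0 : ℝ) 1, |h (s + u) - h s| < ε := by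
  by_contra hcon
  have hbad : ∀ n : ℕ, ∃ s : ℝ, (n : ℝ) ≤ s ∧ ∃ u ∈ Icc (0 : ℝ) 1, ε ≤ |h (s + u) - h s| := by
    intro n
    obtain ⟨s, hs, hs'⟩ := (frequently_atTop.1 (not_eventually.1 hcon)) n
    push Not at hs'
    exact ⟨s, hs, hs'⟩
  choose s hs u hu hbad using hbad
  have hs_top : Tendsto s atTop atTop := tendsto_atTop_mono hs tendsto_natCast_atTop_atTop
  have hsu_top : Tendsto (fun n => s n + u n) atTop atTop :=
    tendsto_atTop_mono (fun n => by linarith [(hu n).1]) hs_top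
  obtain ⟨n, hV, hW⟩ := ((exists_volume_gt_of_tendsto hh (half_pos hε) hs_top).and
    (exists_volume_gt_of_tendsto hh (half_pos hε) hsu_top)).exists
  set V := Icc (0 : ℝ) 2 ∩ {v | ∀ m ≥ n, |h (s m + v) - h (s m)| < ε / 2}
  set W := Icc (0 : ℝ) 2 ∩ {v | ∀ m ≥ n, |h (s m + u m + v) - h (s m + u m)| < ε / 2} with hWdef
  have hWm : MeasurableSet W := by
    refine measurableSet_Icc.inter ?_
    simp only [ofPred_forall]
    refine MeasurableSet.iInter fun m => MeasurableSet.iInter fun _ => ?_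
    exact measurableSet_lt (by fun_prop) measurable_const
  have hpre : MeasureTheory.volume ((fun v => v + -u n) ⁻¹' W) = MeasureTheory.volume W :=
    MeasureTheory.measure_preimage_add_right _ _ _
  -- At a common point `v`, both `h (s n)` and `h (s n + u n)` are within `ε / 2` of `h (s n + v)`.
  have hne : (V ∩ ((fun v => v + -u n) ⁻¹' W)).Nonempty := by
    refine MeasureTheory.nonempty_inter_of_measure_lt_add MeasureTheory.volume
      (u := Icc (0 : ℝ) 3) (hWm.preimage (by fun_prop)) ?_ ?_ ?_
    · intro v hv
      exact ⟨hv.1.1, by linarith [hv.1.2]⟩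
    · intro v hv
      have h1 := hv.1.1
      have h2 := hv.1.2
      have := (hu n).1
      have := (hu n).2
      simp only at h1 h2
      exact ⟨by linarith, by linarith⟩
    · rw [hpre, Real.volume_Icc]
      calc ENNReal.ofReal (3 - 0) = ENNReal.ofReal (3 / 2) + ENNReal.ofReal (3 / 2) := by
            rw [← ENNReal.ofReal_add] <;> norm_num
        _ < _ := ENNReal.add_lt_add hV hW
  obtain ⟨v, hv, hw⟩ := hne
  have h1 := hv.2 n le_rfl
  have h2 := hw.2 n le_rfl
  have h3 := hbad n
  rw [show s n + u n + (v + -u n) = s n + v by ring] at h2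
  have : h (s n + u n) - h (s n) = (h (s n + v) - h (s n)) - (h (s n + v) - h (s n + u n)) := by
    ring
  rw [this] at h3
  linarith [abs_sub (h (s n + v) - h (s n)) (h (s n + v) - h (s n + u n))]

theorem eventually_forall_Icc_abs_log_sub_lt {p : ℝ → ℝ} (hpc : Continuous p)
    (hp : ∀ s, 0 < p s) {ρ : ℝ}
    (hlim : ∀ u, Tendsto (fun s => p (s + u) / p s) atTop (𝓝 (Real.exp (ρ * u))))
    {ε : ℝ} (hε : 0 < ε) :
    ∀ᶠ s in atTop, ∀ u ∈ Icc (0 : ℝ) 1,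
      |Real.log (p (s + u)) - Real.log (p s) - ρ * u| < ε := by
  have hm : Measurable fun s => Real.log (p s) - ρ * s :=
    ((hpc.log fun s => (hp s).ne').sub (by fun_prop)).measurable
  have := eventually_forall_Icc_abs_sub_lt hm (fun u => ?_) hε
  · filter_upwards [this] with s hs u hu
    convert hs u hu using 2
    ring
  · have h1 := ((hlim u).log (Real.exp_pos _).ne').sub_const (ρ * u)
    rw [Real.log_exp, sub_self] at h1
    refine h1.congr fun s => ?_
    rw [Real.log_div (hp _).ne' (hp _).ne']
    ring

/-- A function of positive index at zero is asymptotically increasing. -/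
theorem RegVaryingAtZero.exists_forall_le_mul {f : ℝ → ℝ} {β : ℝ} (hf : RegVaryingAtZero f β)
    (hβ : 0 < β) (hfc : Continuous f) (hpos : ∀ u, 0 < u → 0 < f u) {K : ℝ} (hK : 1 < K) :
    ∃ δ : ℝ, 0 < δ ∧ ∀ u v, 0 < u → u ≤ v → v ≤ δ → f u ≤ K * f v := by
  -- The substitution `u = exp (-s)` turns index `β` at zero into exponential rate `-β` at infinity.
  have hlim : ∀ u, Tendsto (fun s => f (Real.exp (-(s + u))) / f (Real.exp (-s))) atTop
      (𝓝 (Real.exp (-β * u))) := by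
    intro u
    have h1 : Tendsto (fun s : ℝ => Real.exp (-s)) atTop (𝓝[>] 0) :=
      tendsto_nhdsWithin_iff.2 ⟨Real.tendsto_exp_neg_atTop_nhds_zero,
        Eventually.of_forall fun s => Real.exp_pos _⟩
    have h2 := (hf.2 (Real.exp (-u)) (Real.exp_pos _)).comp h1
    rw [← Real.exp_mul] at h2
    convert h2 using 2 with s
    · simp only [Function.comp_apply]
      rw [← Real.exp_add]
      ring_nf
    · ring_nf
  have hlogK := Real.log_pos hK
  obtain ⟨S, hS⟩ := eventually_atTop.1 (eventually_forall_Icc_abs_log_sub_lt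
    (p := fun s => f (Real.exp (-s))) (by fun_prop) (fun s => hpos _ (Real.exp_pos _))
    hlim (lt_min hlogK (half_pos hβ)))
  set ℓ : ℝ → ℝ := fun s => Real.log (f (Real.exp (-s))) with hℓ
  -- Each unit step changes `ℓ` by less than `-β + β / 2 < 0`; only the last fractional step can
  -- cost up to `log K`.
  have hstep : ∀ s ≥ S, ∀ n : ℕ, ℓ (s + n) ≤ ℓ s := by
    intro s hs n
    induction n with
    | zero => simp
    | succ n ih =>
      have h1 := hS (s + n) (by linarith [n.cast_nonneg (α := ℝ)]) 1 ⟨zero_le_one, le_rfl⟩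
      have h2 := (abs_lt.1 h1).2
      have h3 := min_le_right (Real.log K) (β / 2)
      have h4 : ℓ (s + n + 1) - ℓ (s + n) - -β * 1 < β / 2 := h2.trans_le h3
      push_cast
      rw [← add_assoc]
      linarith
  have hall : ∀ s ≥ S, ∀ u ≥ 0, ℓ (s + u) ≤ Real.log K + ℓ s := by
    intro s hs u hu
    have h0 := Nat.floor_le hu
    have h0' := Nat.lt_floor_add_one u
    have h1 := hS (s + ⌊u⌋₊) (by linarith [(⌊u⌋₊).cast_nonneg (α := ℝ)]) (u - ⌊u⌋₊)
      ⟨by linarith, by linarith⟩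
    have h2 := (abs_lt.1 h1).2.trans_le (min_le_left (Real.log K) (β / 2))
    rw [show s + ↑⌊u⌋₊ + (u - ↑⌊u⌋₊) = s + u by ring] at h2
    have h3 := hstep s hs ⌊u⌋₊
    have h4 : 0 ≤ β * (u - ⌊u⌋₊) := mul_nonneg hβ.le (by linarith)
    simp only [hℓ] at h3 ⊢
    linarith
  refine ⟨Real.exp (-S), Real.exp_pos _, fun u v hu huv hv => ?_⟩
  have hv0 := hu.trans_le huv
  have h1 : Real.log v ≤ -S := (Real.log_le_iff_le_exp hv0).2 hv
  have h2 := Real.log_le_log hu huv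
  have h3 := hall (-Real.log v) (by linarith) (Real.log v - Real.log u) (by linarith)
  simp only [hℓ] at h3
  rw [show -(-Real.log v + (Real.log v - Real.log u)) = Real.log u by ring, neg_neg,
    Real.exp_log hu, Real.exp_log hv0,
    ← Real.log_mul (by positivity) (hpos v hv0).ne'] at h3
  exact (Real.log_le_log_iff (hpos u hu) (mul_pos (by positivity) (hpos v hv0))).1 h3

theorem RegVaryingAtTop.exists_forall_abs_log_sub_lt {g : ℝ → ℝ} {α : ℝ}
    (hg : RegVaryingAtTop g α) (hgc : ContinuousOn g (Ioi 0)) (hpos : ∀ t, 0 < t → 0 < g t)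
    {ε : ℝ} (hε : 0 < ε) :
    ∃ c : ℝ, 0 < c ∧ c < 1 ∧ ∀ᶠ t in atTop, ∀ s ∈ Icc (c * t) t,
      |Real.log (g t) - Real.log (g s)| < ε := by
  have hlim : ∀ u, Tendsto (fun s => g (Real.exp (s + u)) / g (Real.exp s)) atTop
      (𝓝 (Real.exp (α * u))) := by
    intro u
    have h2 := (hg.2 (Real.exp u) (Real.exp_pos _)).comp Real.tendsto_exp_atTop
    rw [← Real.exp_mul] at h2
    convert h2 using 2 with s
    · simp only [Function.comp_apply]
      rw [← Real.exp_add, add_comm]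
    · ring_nf
  obtain ⟨S, hS⟩ := eventually_atTop.1 (eventually_forall_Icc_abs_log_sub_lt
    (p := fun s => g (Real.exp s))
    (hgc.comp_continuous Real.continuous_exp fun s => Real.exp_pos s)
    (fun s => hpos _ (Real.exp_pos _)) hlim (half_pos hε))
  obtain ⟨η, hη0, hη⟩ : ∃ η : ℝ, 0 < η ∧ η ≤ 1 ∧ |α| * η ≤ ε / 2 := by
    refine ⟨min 1 (ε / 2 / (|α| + 1)), by positivity, min_le_left _ _, ?_⟩
    calc |α| * min 1 (ε / 2 / (|α| + 1)) ≤ (|α| + 1) * (ε / 2 / (|α| + 1)) := by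
          gcongr
          · linarith
          · exact min_le_right _ _
      _ = ε / 2 := by field_simp
  refine ⟨Real.exp (-η), Real.exp_pos _, Real.exp_lt_one_iff.2 (by linarith), ?_⟩
  filter_upwards [eventually_gt_atTop (0 : ℝ), eventually_ge_atTop (Real.exp (S + η))]
    with t ht htS s hs
  have hs0 : 0 < s := (mul_pos (Real.exp_pos _) ht).trans_le hs.1
  have h1 : Real.log s ≤ Real.log t := Real.log_le_log hs0 hs.2
  have h2 : -η + Real.log t ≤ Real.log s := by
    have := Real.log_le_log (mul_pos (Real.exp_pos _) ht) hs.1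
    rwa [Real.log_mul (Real.exp_pos _).ne' ht.ne', Real.log_exp] at this
  have h3 : S + η ≤ Real.log t := (Real.le_log_iff_exp_le ht).2 htS
  have h4 := hS (Real.log s) (by linarith) (Real.log t - Real.log s) ⟨by linarith, by linarith⟩
  rw [add_sub_cancel, Real.exp_log hs0, Real.exp_log ht] at h4
  have h5 : |α * (Real.log t - Real.log s)| ≤ ε / 2 := by
    rw [abs_mul, abs_of_nonneg (sub_nonneg.2 h1)]
    exact (mul_le_mul_of_nonneg_left (by linarith) (abs_nonneg α)).trans hη.2
  have h6 := abs_lt.1 h4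
  have h7 := abs_le.1 h5
  exact abs_lt.2 ⟨by linarith, by linarith⟩

/-! ### Barrier lemmas -/

/-- Time is reversed from `t`: the path cannot cross the line `z t - κ r`, and at a contact point `z
s ≤ z t`, so the derivative bound is needed only there. -/
theorem le_sub_mul_of_lt_deriv {z z' : ℝ → ℝ} {T t κ : ℝ} (hTt : T ≤ t) (hκ : 0 ≤ κ)
    (hz : ∀ s ∈ Icc T t, HasDerivAt z (z' s) s)
    (h : ∀ s ∈ Icc T t, z s ≤ z t → κ < z' s) : z T ≤ z t - κ * (t - T) := by
  have hmem : ∀ r ∈ Icc 0 (t - T), t - r ∈ Icc T t := fun r hr =>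
    ⟨by linarith [hr.2], by linarith [hr.1]⟩
  have hd : ∀ r ∈ Icc 0 (t - T), HasDerivAt (fun r => z (t - r)) (-z' (t - r)) r := by
    intro r hr
    have := (hz _ (hmem r hr)).comp r ((hasDerivAt_id r).const_sub t)
    simpa [Function.comp_def] using this
  have hB : ∀ r, HasDerivAt (fun r => z t - κ * r) (-κ) r := fun r => by
    simpa using ((hasDerivAt_id r).const_mul κ).const_sub (z t)
  have := image_le_of_deriv_right_lt_deriv_boundary (f := fun r => z (t - r))
    (f' := fun r => -z' (t - r)) (a := 0) (b := t - T) (B := fun r => z t - κ * r)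
    (B' := fun _ => -κ)
    (fun r hr => (hd r hr).continuousAt.continuousWithinAt)
    (fun r hr => (hd r (Ico_subset_Icc_self hr)).hasDerivWithinAt) (by simp) hB
    (fun r hr hr' => by
      have h1 := h _ (hmem r (Ico_subset_Icc_self hr))
        (by rw [hr']; linarith [mul_nonneg hκ hr.1])
      linarith)
    (x := t - T) ⟨by linarith, le_rfl⟩
  simpa using this

theorem add_mul_le_of_deriv_lt {z z' : ℝ → ℝ} {T t κ : ℝ} (hTt : T ≤ t) (hκ : 0 ≤ κ)
    (hz : ∀ s ∈ Icc T t, HasDerivAt z (z' s) s)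
    (h : ∀ s ∈ Icc T t, z t ≤ z s → z' s < -κ) : z t + κ * (t - T) ≤ z T := by
  have := le_sub_mul_of_lt_deriv (z := fun s => -z s) (z' := fun s => -z' s) hTt hκ
    (fun s hs => (hz s hs).neg) (fun s hs hs' => by
      have := h s hs (by linarith)
      linarith)
  linarith

/-- A late time with `v t ≥ 0` would force, running backwards, `v T ≥ κ (t - T)`, which fails for
large `t`. -/
theorem eventually_neg_of_deriv_lt {v v' : ℝ → ℝ} {κ : ℝ} (hκ : 0 < κ)
    (hv : ∀ᶠ t in atTop, HasDerivAt v (v' t) t)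
    (h : ∀ᶠ t in atTop, 0 ≤ v t → v' t < -κ) : ∀ᶠ t in atTop, v t < 0 := by
  obtain ⟨T, hT⟩ := eventually_atTop.1 (hv.and h)
  filter_upwards [eventually_ge_atTop T, eventually_gt_atTop (T + v T / κ)] with t ht ht'
  by_contra! hvt
  have h1 := add_mul_le_of_deriv_lt ht hκ.le (fun s hs => (hT s hs.1).1)
    (fun s hs hs' => (hT s hs.1).2 (hvt.trans hs'))
  have h2 : v T / κ * κ = v T := div_mul_cancel₀ _ hκ.ne'
  nlinarith

/-! ### The functions `F` and `F⁻¹` -/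

section OdeF

variable {f : ℝ → ℝ}

theorem hasDerivAt_odeF (hfc : Continuous f) (hpos : ∀ u, 0 < u → 0 < f u) {u : ℝ} (hu : 0 < u) :
    HasDerivAt (odeF f) (-(1 / f u)) u := by
  have hc : ContinuousOn (fun u => 1 / f u) (Ioi 0) :=
    continuousOn_const.div hfc.continuousOn fun x hx => (hpos x hx).ne'
  have hsub : uIcc u 1 ⊆ Ioi 0 := fun x hx => (lt_min hu one_pos).trans_le hx.1
  exact intervalIntegral.integral_hasDerivAt_left (hc.mono hsub).intervalIntegrable
    (hc.stronglyMeasurableAtFilter isOpen_Ioi u hu) (hc.continuousAt (Ioi_mem_nhds hu))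

theorem continuousOn_odeF (hfc : Continuous f) (hpos : ∀ u, 0 < u → 0 < f u) :
    ContinuousOn (odeF f) (Ioi 0) :=
  fun _ hu => (hasDerivAt_odeF hfc hpos hu).continuousAt.continuousWithinAt

theorem strictAntiOn_odeF (hfc : Continuous f) (hpos : ∀ u, 0 < u → 0 < f u) :
    StrictAntiOn (odeF f) (Ioi 0) := by
  refine strictAntiOn_of_deriv_neg (convex_Ioi 0) (continuousOn_odeF hfc hpos) fun u hu => ?_
  rw [interior_Ioi] at hu
  rw [(hasDerivAt_odeF hfc hpos hu).deriv, neg_lt_zero]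
  exact one_div_pos.2 (hpos u hu)

theorem antitoneOn_Ioc_of_hasDerivAt_nonpos {D D' : ℝ → ℝ} {δ : ℝ}
    (hD : ∀ u ∈ Ioc 0 δ, HasDerivAt D (D' u) u) (hD' : ∀ u ∈ Ioc 0 δ, D' u ≤ 0) :
    AntitoneOn D (Ioc 0 δ) := by
  refine antitoneOn_of_deriv_nonpos (convex_Ioc 0 δ)
    (fun u hu => (hD u hu).continuousAt.continuousWithinAt)
    (fun u hu => (hD u (interior_subset hu)).differentiableAt.differentiableWithinAt)
    fun u hu => ?_
  rw [(hD u (interior_subset hu)).deriv]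
  exact hD' u (interior_subset hu)

theorem tendsto_odeF_atTop (hfc : Continuous f) (hpos : ∀ u, 0 < u → 0 < f u)
    (hlip : LocallyLipschitz f) (h0 : f 0 = 0) : Tendsto (odeF f) (𝓝[>] 0) atTop := by
  obtain ⟨C, t, ht, hC⟩ := hlip 0
  obtain ⟨ε, hε, hball⟩ := Metric.mem_nhds_iff.1 ht
  set K : ℝ := C + 1 with hKdef
  have hK : 0 < K := by positivity
  have hle : ∀ u ∈ Ioc 0 (ε / 2), f u ≤ K * u := by
    intro u hu
    have hu1 : u ∈ t := hball (by
      rw [Metric.mem_ball, Real.dist_eq, sub_zero, abs_of_pos hu.1]; linarith [hu.2])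
    have h1 := hC.dist_le_mul u hu1 0 (mem_of_mem_nhds ht)
    rw [h0, Real.dist_eq, Real.dist_eq, sub_zero, sub_zero, abs_of_pos hu.1] at h1
    nlinarith [le_abs_self (f u), hu.1]
  -- Since `f u ≤ K u`, `F` grows at least as fast as `-K⁻¹ log u` near zero.
  have hanti : AntitoneOn (fun u => odeF f u + K⁻¹ * Real.log u) (Ioc 0 (ε / 2)) := by
    refine antitoneOn_Ioc_of_hasDerivAt_nonpos
      (fun u hu => (hasDerivAt_odeF hfc hpos hu.1).add
        ((Real.hasDerivAt_log hu.1.ne').const_mul K⁻¹)) fun u hu => ?_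
    rw [← mul_inv, ← one_div (K * u)]
    linarith [one_div_le_one_div_of_le (hpos u hu.1) (hle u hu)]
  have hlog : Tendsto (fun u => odeF f (ε / 2) + K⁻¹ * Real.log (ε / 2) + -(K⁻¹ * Real.log u))
      (𝓝[>] 0) atTop := by
    refine tendsto_atTop_add_const_left _ _ (tendsto_neg_atBot_atTop.comp ?_)
    exact Real.tendsto_log_nhdsGT_zero.const_mul_atBot (inv_pos.2 hK)
  refine tendsto_atTop_mono' _ ?_ hlog
  filter_upwards [Ioc_mem_nhdsGT (half_pos hε)] with u hu
  have := hanti hu ⟨half_pos hε, le_rfl⟩ hu.2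
  simp only at this
  linarith

theorem odeFInv_spec (hfc : Continuous f) (hpos : ∀ u, 0 < u → 0 < f u)
    (htop : Tendsto (odeF f) (𝓝[>] 0) atTop) {t : ℝ} (ht : 0 ≤ t) :
    0 < odeFInv f t ∧ odeF f (odeFInv f t) = t := by
  obtain ⟨u, hu1, hu2⟩ := ((htop.eventually_ge_atTop t).and
    (Ioc_mem_nhdsGT (one_pos (α := ℝ)))).exists
  have h1 : odeF f 1 = 0 := by simp [odeF]
  obtain ⟨w, hw, hw'⟩ := intermediate_value_Icc' hu2.2
    ((continuousOn_odeF hfc hpos).mono fun x hx => hu2.1.trans_le hx.1) ⟨h1.le.trans ht, hu1⟩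
  have hex : ∃ a ∈ Ioi (0 : ℝ), odeF f a = t := ⟨w, hu2.1.trans_le hw.1, hw'⟩
  exact ⟨Function.invFunOn_mem hex, Function.invFunOn_eq hex⟩

theorem odeFInv_odeF (hfc : Continuous f) (hpos : ∀ u, 0 < u → 0 < f u) {u : ℝ} (hu : 0 < u) :
    odeFInv f (odeF f u) = u :=
  (strictAntiOn_odeF hfc hpos).injOn.leftInvOn_invFunOn hu

theorem tendsto_odeFInv (hfc : Continuous f) (hpos : ∀ u, 0 < u → 0 < f u)
    (htop : Tendsto (odeF f) (𝓝[>] 0) atTop) : Tendsto (odeFInv f) atTop (𝓝[>] 0) := by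
  refine tendsto_nhdsWithin_iff.2 ⟨tendsto_order.2 ⟨fun a ha => ?_, fun a ha => ?_⟩, ?_⟩
  · filter_upwards [eventually_ge_atTop 0] with t ht
    exact ha.trans (odeFInv_spec hfc hpos htop ht).1
  · filter_upwards [eventually_ge_atTop 0, eventually_gt_atTop (odeF f a)] with t ht hta
    obtain ⟨h1, h2⟩ := odeFInv_spec hfc hpos htop ht
    rw [← h2] at hta
    exact ((strictAntiOn_odeF hfc hpos).lt_iff_gt ha h1).1 hta
  · filter_upwards [eventually_ge_atTop 0] with t ht
    exact (odeFInv_spec hfc hpos htop ht).1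

/-- A one-sided l'Hôpital rule: the derivatives of `F (μ u)` and `F u` have ratio tending to `μ ^ (1
- β)`. The gap `a - κ`, multiplied by `F → ∞`, absorbs the integration constant. -/
theorem RegVaryingAtZero.eventually_odeF_mul_le {β : ℝ} (hf : RegVaryingAtZero f β)
    (hfc : Continuous f) (hpos : ∀ u, 0 < u → 0 < f u)
    (htop : Tendsto (odeF f) (𝓝[>] 0) atTop) (hβ : 1 < β) {a μ : ℝ} (hμ : 0 < μ)
    (h : μ ^ (1 - β) < a) :
    ∀ᶠ u in 𝓝[>] 0, odeF f (μ * u) ≤ a * odeF f u := by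
  obtain ⟨κ, hκ1, hκ2⟩ := exists_between h
  have hlim : Tendsto (fun u => μ * (f (μ * u) / f u)⁻¹) (𝓝[>] 0) (𝓝 (μ ^ (1 - β))) := by
    have := ((hf.2 μ hμ).inv₀ (Real.rpow_pos_of_pos hμ _).ne').const_mul μ
    rwa [← Real.rpow_neg hμ.le, ← Real.rpow_one_add' hμ.le (by linarith : (1 : ℝ) + -β < 0).ne, ← sub_eq_add_neg] at this
  obtain ⟨δ, hδ, hδ'⟩ := mem_nhdsGT_iff_exists_Ioc_subset.1 (hlim.eventually_lt_const hκ1)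
  have hδ0 : (0 : ℝ) < δ := hδ
  have hanti : AntitoneOn (fun u => κ * odeF f u - odeF f (μ * u)) (Ioc 0 δ) := by
    refine antitoneOn_Ioc_of_hasDerivAt_nonpos
      (D' := fun u => κ * -(1 / f u) - -(1 / f (μ * u)) * μ) (fun u hu => ?_) fun u hu => ?_
    · have h1 := (hasDerivAt_odeF hfc hpos (mul_pos hμ hu.1)).comp u
        ((hasDerivAt_id u).const_mul μ)
      simp only [mul_one] at h1
      exact ((hasDerivAt_odeF hfc hpos hu.1).const_mul κ).sub h1
    · have h1 : μ * (f (μ * u) / f u)⁻¹ < κ := hδ' hu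
      have h2 := hpos u hu.1
      have h3 := hpos _ (mul_pos hμ hu.1)
      have h4 : κ * -(1 / f u) - -(1 / f (μ * u)) * μ
          = (μ * (f (μ * u) / f u)⁻¹ - κ) * (1 / f u) := by
        field_simp
        ring
      rw [h4]
      exact mul_nonpos_of_nonpos_of_nonneg (by linarith) (by positivity)
  set C := κ * odeF f δ - odeF f (μ * δ)
  filter_upwards [Ioc_mem_nhdsGT hδ0,
    htop.eventually_ge_atTop (-C / (a - κ))] with u hu hu'
  have h1 : C ≤ κ * odeF f u - odeF f (μ * u) := hanti hu ⟨hδ0, le_rfl⟩ hu.2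
  rw [div_le_iff₀ (sub_pos.2 hκ2)] at hu'
  linarith

/-- `f ∘ F⁻¹` is asymptotically decreasing and of index at most `-β / (β - 1)` at infinity. -/
theorem RegVaryingAtZero.eventually_forall_comp_odeFInv_le {β : ℝ} (hf : RegVaryingAtZero f β)
    (hβ : 1 < β) (hfc : Continuous f) (hpos : ∀ u, 0 < u → 0 < f u)
    (htop : Tendsto (odeF f) (𝓝[>] 0) atTop) {a K : ℝ} (ha : 0 < a)
    (hK : a ^ (-(β / (β - 1))) < K) :
    ∀ᶠ t in atTop, ∀ s ≥ a * t, f (odeFInv f s) ≤ K * f (odeFInv f t) := by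
  have hβ1 : 0 < β - 1 := by linarith
  -- The lower bound on `μ` gives `F⁻¹(a t) ≤ μ F⁻¹(t)`; then `f` scales by about `μ ^ β < K`,
  -- leaving room for the factor `k` lost to almost-monotonicity.
  obtain ⟨μ, hμa, hμK⟩ : ∃ μ, a ^ (-(1 / (β - 1))) < μ ∧ μ ^ β < K := by
    have hc : ContinuousAt (fun μ : ℝ => μ ^ β) (a ^ (-(1 / (β - 1)))) :=
      Real.continuousAt_rpow_const _ _ (Or.inr (by linarith))
    have h1 : (a ^ (-(1 / (β - 1)))) ^ β < K := by
      rwa [← Real.rpow_mul ha.le, show -(1 / (β - 1)) * β = -(β / (β - 1)) by ring]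
    have h2 := (hc.eventually_lt_const h1).filter_mono
      (nhdsWithin_le_nhds (s := Ioi (a ^ (-(1 / (β - 1))))))
    obtain ⟨μ, h3, h4⟩ := (h2.and self_mem_nhdsWithin).exists
    exact ⟨μ, h4, h3⟩
  have hμ0 : 0 < μ := (Real.rpow_pos_of_pos ha _).trans hμa
  have hμ1 : μ ^ (1 - β) < a := by
    have := Real.rpow_lt_rpow_of_neg (Real.rpow_pos_of_pos ha _) hμa (by linarith : 1 - β < 0)
    rwa [← Real.rpow_mul ha.le, show -(1 / (β - 1)) * (1 - β) = 1 by field_simp; ring,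
      Real.rpow_one] at this
  have hμβ := Real.rpow_pos_of_pos hμ0 β
  obtain ⟨k, hk1, hk2⟩ := exists_between ((one_lt_div hμβ).2 hμK)
  have hk0 : 0 < k := one_pos.trans hk1
  have hμk : μ ^ β < K / k := by
    rw [lt_div_iff₀ hμβ] at hk2
    rw [lt_div_iff₀ hk0]
    linarith
  obtain ⟨δ, hδ, hmono⟩ := hf.exists_forall_le_mul (by linarith) hfc hpos hk1
  have hy := tendsto_odeFInv hfc hpos htop
  filter_upwards [hy.eventually (hf.eventually_odeF_mul_le hfc hpos htop hβ hμ0 hμ1),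
    hy.eventually ((hf.2 μ hμ0).eventually_lt_const hμk),
    hy.eventually (Ioc_mem_nhdsGT (div_pos hδ hμ0)), eventually_ge_atTop 0] with t h1 h2 h3 ht s hs
  have hs0 : 0 ≤ s := (mul_nonneg ha.le ht).trans hs
  obtain ⟨hyt, hFt⟩ := odeFInv_spec hfc hpos htop ht
  obtain ⟨hys, hFs⟩ := odeFInv_spec hfc hpos htop hs0
  have h4 : odeFInv f s ≤ μ * odeFInv f t := by
    rw [hFt] at h1
    rw [← (strictAntiOn_odeF hfc hpos).le_iff_ge (mul_pos hμ0 hyt) hys, hFs]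
    exact h1.trans hs
  have h5 : μ * odeFInv f t ≤ δ := by
    have := (le_div_iff₀ hμ0).1 h3.2
    linarith
  have h6 := hmono _ _ hys h4 h5
  rw [div_lt_iff₀ (hpos _ hyt)] at h2
  calc f (odeFInv f s) ≤ k * f (μ * odeFInv f t) := h6
    _ ≤ k * (K / k * f (odeFInv f t)) := by gcongr
    _ = K * f (odeFInv f t) := by field_simp

end OdeF

/-! ### The equation `z' = 1 - g / φ(z)` -/

section Comparison

variable {φ g z : ℝ → ℝ} {γ : ℝ}

/-- Where `z ≥ b t`, `φ(z) ≤ K φ(t)` with `K` just above `b ^ (-γ)`, so `z' ≤ 1 - m / K < b` and `z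
- b t` has strictly negative drift. -/
theorem eventually_lt_mul_of_mul_le (hφ : ∀ᶠ t in atTop, 0 < φ t)
    (hz : ∀ᶠ t in atTop, HasDerivAt z (1 - g t / φ (z t)) t) (hz_top : Tendsto z atTop atTop)
    (hA : ∀ a K : ℝ, 0 < a → a ^ (-γ) < K → ∀ᶠ t in atTop, ∀ s ≥ a * t, φ s ≤ K * φ t)
    {b m : ℝ} (hb : 0 < b) (hm : 0 ≤ m) (hg : ∀ᶠ t in atTop, m * φ t ≤ g t)
    (h : 1 - b < m * b ^ γ) : ∀ᶠ t in atTop, z t < b * t := by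
  have hbγ := Real.rpow_pos_of_pos hb (-γ)
  obtain ⟨K, hK, hK'⟩ : ∃ K, b ^ (-γ) < K ∧ 1 - m / K < b := by
    have hc : ContinuousAt (fun K : ℝ => 1 - m / K) (b ^ (-γ)) :=
      continuousAt_const.sub (continuousAt_const.div continuousAt_id hbγ.ne')
    have h1 : 1 - m / b ^ (-γ) < b := by
      rw [Real.rpow_neg hb.le, div_inv_eq_mul]
      linarith
    obtain ⟨K, h3, h4⟩ := (((hc.eventually_lt_const h1).filter_mono
      (nhdsWithin_le_nhds (s := Ioi (b ^ (-γ))))).and self_mem_nhdsWithin).exists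
    exact ⟨K, h4, h3⟩
  have hK0 : 0 < K := hbγ.trans hK
  obtain ⟨κ, hκ0, hκ⟩ := exists_between (sub_pos.2 hK')
  have hv := eventually_neg_of_deriv_lt (v := fun t => z t - b * t)
    (v' := fun t => 1 - g t / φ (z t) - b) hκ0 (hz.mono fun t ht => by
      simpa [Pi.sub_def] using ht.sub ((hasDerivAt_id t).const_mul b)) ?_
  · filter_upwards [hv] with t ht
    linarith
  · filter_upwards [hφ, hz_top.eventually hφ, hg, hA b K hb hK] with t h1 h2 h3 h4 h5
    have h6 := h4 (z t) (by linarith)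
    have h7 : m / K ≤ g t / φ (z t) := by
      rw [div_le_div_iff₀ hK0 h2]
      nlinarith
    linarith

theorem eventually_mul_lt_of_le_mul (hφ : ∀ᶠ t in atTop, 0 < φ t)
    (hz : ∀ᶠ t in atTop, HasDerivAt z (1 - g t / φ (z t)) t) (hz_top : Tendsto z atTop atTop)
    (hA : ∀ a K : ℝ, 0 < a → a ^ (-γ) < K → ∀ᶠ t in atTop, ∀ s ≥ a * t, φ s ≤ K * φ t)
    {a m : ℝ} (ha : 0 < a) (hm : 0 ≤ m) (hg : ∀ᶠ t in atTop, g t ≤ m * φ t)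
    (h : m * a ^ γ < 1 - a) : ∀ᶠ t in atTop, a * t < z t := by
  have haγ : a⁻¹ ^ (-γ) = a ^ γ := by
    rw [Real.inv_rpow ha.le, Real.rpow_neg ha.le, inv_inv]
  obtain ⟨K, hK, hK'⟩ : ∃ K, a ^ γ < K ∧ m * K < 1 - a := by
    have hc : ContinuousAt (fun K : ℝ => m * K) (a ^ γ) := by fun_prop
    obtain ⟨K, h3, h4⟩ := (((hc.eventually_lt_const h).filter_mono
      (nhdsWithin_le_nhds (s := Ioi (a ^ γ)))).and self_mem_nhdsWithin).exists
    exact ⟨K, h4, h3⟩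
  obtain ⟨κ, hκ0, hκ⟩ := exists_between (sub_pos.2 hK')
  have hv := eventually_neg_of_deriv_lt (v := fun t => a * t - z t)
    (v' := fun t => a - (1 - g t / φ (z t))) hκ0 (hz.mono fun t ht => by
      simpa [Pi.sub_def] using ((hasDerivAt_id t).const_mul a).sub ht) ?_
  · filter_upwards [hv] with t ht
    linarith
  -- Here `z t ≤ a t`, so `hA` is used at base point `z t` with factor `a⁻¹`, bounding `φ t` by `K
  -- φ(z t)`.
  · filter_upwards [hz_top.eventually hφ, hg,
      hz_top.eventually (hA a⁻¹ K (inv_pos.2 ha) (haγ ▸ hK))] with t h2 h3 h4 h5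
    have h6 := h4 t (by
      rw [ge_iff_le, inv_mul_le_iff₀ ha]
      linarith)
    have h7 : g t / φ (z t) ≤ m * K := by
      rw [div_le_iff₀ h2]
      nlinarith
    linarith

theorem tendsto_div_of_tendsto_div (hγ : 0 < γ) (hφ : ∀ᶠ t in atTop, 0 < φ t)
    (hz : ∀ᶠ t in atTop, HasDerivAt z (1 - g t / φ (z t)) t) (hz_top : Tendsto z atTop atTop)
    (hA : ∀ a K : ℝ, 0 < a → a ^ (-γ) < K → ∀ᶠ t in atTop, ∀ s ≥ a * t, φ s ≤ K * φ t)
    (hgpos : ∀ᶠ t in atTop, 0 < g t) {l Λ : ℝ} (hl : 0 ≤ l)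
    (hlim : Tendsto (fun t => g t / φ t) atTop (𝓝 l)) (hΛ : 0 < Λ) (hΛl : 1 - Λ = l * Λ ^ γ) :
    Tendsto (fun t => z t / t) atTop (𝓝 Λ) := by
  refine tendsto_order.2 ⟨fun a ha => ?_, fun b hb => ?_⟩
  · obtain ⟨a', ha', haΛ⟩ := exists_between (max_lt ha hΛ)
    have ha0 : 0 < a' := (le_max_right _ _).trans_lt ha'
    have haγ := Real.rpow_pos_of_pos ha0 γ
    have h1 : l < (1 - a') / a' ^ γ := by
      rw [lt_div_iff₀ haγ]
      have := mul_le_mul_of_nonneg_left (Real.rpow_le_rpow ha0.le haΛ.le hγ.le) hl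
      linarith
    obtain ⟨m, hm1, hm2⟩ := exists_between h1
    have h2 : ∀ᶠ t in atTop, g t ≤ m * φ t := by
      filter_upwards [hlim.eventually_lt_const hm1, hφ] with t ht ht'
      exact ((div_lt_iff₀ ht').1 ht).le
    filter_upwards [eventually_mul_lt_of_le_mul hφ hz hz_top hA ha0 (hl.trans hm1.le) h2
      ((lt_div_iff₀ haγ).1 hm2), eventually_gt_atTop 0] with t ht ht0
    rw [lt_div_iff₀ ht0]
    exact (mul_lt_mul_of_pos_right ((le_max_left _ _).trans_lt ha') ht0).trans ht
  · have hb0 := hΛ.trans hb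
    have hbγ := Real.rpow_pos_of_pos hb0 γ
    have h1 : (1 - b) / b ^ γ < l := by
      rw [div_lt_iff₀ hbγ]
      have := mul_le_mul_of_nonneg_left (Real.rpow_le_rpow hΛ.le hb.le hγ.le) hl
      linarith
    obtain ⟨m, hm1, hm2⟩ := exists_between h1
    -- `m` may be negative when `b > 1`; positivity of `g` allows truncation at 0.
    have h2 : ∀ᶠ t in atTop, max m 0 * φ t ≤ g t := by
      filter_upwards [hlim.eventually_const_lt hm2, hφ, hgpos] with t ht ht' ht''
      rw [max_mul_of_nonneg _ _ ht'.le, zero_mul]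
      exact max_le ((lt_div_iff₀ ht').1 ht).le ht''.le
    have h3 : 1 - b < max m 0 * b ^ γ :=
      ((div_lt_iff₀ hbγ).1 hm1).trans_le (mul_le_mul_of_nonneg_right (le_max_left _ _) hbγ.le)
    filter_upwards [eventually_lt_mul_of_mul_le hφ hz hz_top hA hb0 (le_max_right _ _) h2 h3,
      eventually_gt_atTop 0] with t ht ht0
    rwa [div_lt_iff₀ ht0]

theorem tendsto_comp_div_of_tendsto_div_atTop (hφ : ∀ᶠ t in atTop, 0 < φ t)
    (hz : ∀ᶠ t in atTop, HasDerivAt z (1 - g t / φ (z t)) t) (hz_top : Tendsto z atTop atTop)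
    (hA : ∀ a K : ℝ, 0 < a → a ^ (-γ) < K → ∀ᶠ t in atTop, ∀ s ≥ a * t, φ s ≤ K * φ t)
    (hgpos : ∀ᶠ t in atTop, 0 < g t)
    (hg : ∀ ε : ℝ, 0 < ε → ∃ c : ℝ, 0 < c ∧ c < 1 ∧ ∀ᶠ t in atTop, ∀ s ∈ Icc (c * t) t,
      |Real.log (g t) - Real.log (g s)| < ε)
    (hlim : Tendsto (fun t => g t / φ t) atTop atTop) :
    Tendsto (fun t => φ (z t) / g t) atTop (𝓝 1) := by
  have hsmall : ∀ c : ℝ, 0 < c → ∀ᶠ t in atTop, z t < c * t := by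
    intro c hc
    have hcγ := Real.rpow_pos_of_pos hc γ
    refine eventually_lt_mul_of_mul_le hφ hz hz_top hA (m := 1 / c ^ γ) hc (by positivity) ?_ ?_
    · filter_upwards [hlim.eventually_ge_atTop (1 / c ^ γ), hφ] with t h1 h2
      exact (le_div_iff₀ h2).1 h1
    · rw [one_div_mul_cancel hcγ.ne']
      linarith
  suffices hlog : Tendsto (fun t => Real.log (φ (z t) / g t)) atTop (𝓝 0) by
    have := (Real.continuous_exp.tendsto 0).comp hlog
    rw [Real.exp_zero] at this
    refine this.congr' ?_
    filter_upwards [hz_top.eventually hφ, hgpos] with t h1 h2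
    exact Real.exp_log (div_pos h1 h2)
  refine Metric.tendsto_nhds.2 fun ε hε => ?_
  -- Of the assumed gap `ε = 4δ`, one `δ` goes to the variation of `log g` and one to the
  -- almost-monotonicity of `φ`; the rest keeps `g / φ(z)` beyond `exp (±δ)`.
  set δ := ε / 4 with hδdef
  have hδ : 0 < δ := by positivity
  obtain ⟨c, hc0, hc1, hgc⟩ := hg δ hδ
  obtain ⟨N, hN⟩ := eventually_atTop.1 (hA 1 (Real.exp δ) one_pos (by simpa using hδ))
  obtain ⟨T₀, hT₀⟩ := eventually_atTop.1 (((hz_top.eventually_ge_atTop N).and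
    ((hz_top.eventually hφ).and (hgpos.and hz))).and
      ((hz_top.eventually_gt_atTop 0).and (eventually_ge_atTop 0)))
  have hlogle : ∀ s ≥ T₀, ∀ t ≥ T₀, z s ≤ z t →
      Real.log (φ (z t)) ≤ δ + Real.log (φ (z s)) := by
    intro s hs t ht hst
    have h1 := hN (z s) (hT₀ s hs).1.1 (z t) (by simpa using hst)
    have h2 := Real.log_le_log (hT₀ t ht).1.2.1 h1
    rwa [Real.log_mul (Real.exp_pos _).ne' (hT₀ s hs).1.2.1.ne', Real.log_exp] at h2
  have hquot : ∀ s ≥ T₀, g s / φ (z s) = Real.exp (Real.log (g s) - Real.log (φ (z s))) := by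
    intro s hs
    rw [Real.exp_sub, Real.exp_log (hT₀ s hs).1.2.2.1, Real.exp_log (hT₀ s hs).1.2.1]
  obtain ⟨κ, hκ0, hκ⟩ : ∃ κ, 0 < κ ∧ κ < 1 - Real.exp (-δ) :=
    exists_between (sub_pos.2 (Real.exp_lt_one_iff.2 (by linarith)))
  have hκ' : κ < Real.exp δ - 1 := by
    have h1 := Real.add_one_le_exp δ
    have h2 := Real.add_one_le_exp (-δ)
    linarith
  filter_upwards [hgc, hsmall (κ * (1 - c)) (mul_pos hκ0 (by linarith)),
    (tendsto_id.const_mul_atTop hc0).eventually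
      (hsmall (κ * (1 - c)) (mul_pos hκ0 (by linarith))),
    (tendsto_id.const_mul_atTop hc0).eventually_ge_atTop T₀, eventually_ge_atTop T₀,
    eventually_gt_atTop 0] with t h1 h2 h3 h4 h5 ht0
  simp only [id] at h3 h4
  have hct : c * t ≤ t := by nlinarith
  have hd : ∀ s ∈ Icc (c * t) t, HasDerivAt z (1 - g s / φ (z s)) s := fun s hs =>
    (hT₀ s (h4.trans hs.1)).1.2.2.2
  have hzt := (hT₀ t h5).2.1
  have hzc := (hT₀ _ h4).2.1
  have hw : κ * (t - c * t) = κ * (1 - c) * t := by ring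
  rw [Real.dist_eq, sub_zero,
    Real.log_div (hT₀ t h5).1.2.1.ne' (hT₀ t h5).1.2.2.1.ne', abs_lt]
  constructor
  · by_contra! hcon
    have := add_mul_le_of_deriv_lt hct hκ0.le hd fun s hs hst => by
      have hs0 := h4.trans hs.1
      have e1 := hlogle t h5 s hs0 hst
      have e2 := (abs_lt.1 (h1 s hs)).2
      have e3 : Real.exp δ ≤ g s / φ (z s) := by
        rw [hquot s hs0]
        exact Real.exp_le_exp.2 (by linarith)
      linarith
    have e4 : κ * (1 - c) * (c * t) ≤ κ * (1 - c) * t :=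
      mul_le_mul_of_nonneg_left hct (mul_nonneg hκ0.le (by linarith))
    linarith
  · by_contra! hcon
    have := le_sub_mul_of_lt_deriv hct hκ0.le hd fun s hs hst => by
      have hs0 := h4.trans hs.1
      have e1 := hlogle s hs0 t h5 hst
      have e2 := (abs_lt.1 (h1 s hs)).1
      have e3 : g s / φ (z s) ≤ Real.exp (-δ) := by
        rw [hquot s hs0]
        exact Real.exp_le_exp.2 (by linarith)
      linarith
    linarith

end Comparison

/-! ### The perturbed equation -/

/-- If `x t ≤ 0`, then `x' > 0` at every level below `x t`, so the backward barrier keeps `x ≤ 0` on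
`(0, t]`, contradicting `x → ξ > 0` at 0. -/
theorem IsPerturbedSolution.pos {f g x : ℝ → ℝ} {ξ : ℝ} (hx : IsPerturbedSolution f g ξ x)
    (hξ : 0 < ξ) (hneg : ∀ u, u ≤ 0 → f u ≤ 0) (hg : ∀ t, 0 < t → 0 < g t) {t : ℝ}
    (ht : 0 ≤ t) : 0 < x t := by
  rcases ht.eq_or_lt with rfl | ht
  · rwa [hx.initial]
  by_contra! hxt
  have h1 : ∀ T ∈ Ioc 0 t, x T ≤ 0 := by
    intro T hT
    have := le_sub_mul_of_lt_deriv hT.2 le_rfl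
      (fun s hs => hx.hasDerivAt s (hT.1.trans_le hs.1)) fun s hs hst => by
        have e1 := hneg _ (hst.trans hxt)
        have e2 := hg s (hT.1.trans_le hs.1)
        linarith
    linarith
  have h2 : Tendsto x (𝓝[>] 0) (𝓝 ξ) := by
    rw [← hx.initial]
    exact (hx.continuousOn 0 self_mem_Ici).mono_left (nhdsWithin_mono 0 Ioi_subset_Ici_self)
  obtain ⟨T, h3, h4⟩ := ((h2.eventually_const_lt hξ).and (Ioc_mem_nhdsGT ht)).exists
  exact (h1 T h4).not_gt h3

theorem strictMonoOn_mul_rpow_add_id {l γ : ℝ} (hl : 0 ≤ l) (hγ : 0 < γ) :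
    StrictMonoOn (fun Λ : ℝ => l * Λ ^ γ + Λ) (Ici 0) := by
  intro a ha b _ hab
  have := mul_le_mul_of_nonneg_left (Real.rpow_le_rpow ha hab.le hγ.le) hl
  simp only
  linarith

theorem exists_mem_Ioo_mul_rpow_add_eq_one {l γ : ℝ} (hl : 0 < l) (hγ : 0 < γ) :
    ∃ Λ ∈ Ioo (0 : ℝ) 1, l * Λ ^ γ + Λ = 1 := by
  have hc : ContinuousOn (fun Λ : ℝ => l * Λ ^ γ + Λ) (Icc 0 1) :=
    (((Real.continuous_rpow_const hγ.le).const_mul l).add continuous_id).continuousOn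
  exact intermediate_value_Ioo zero_le_one hc
    ⟨by simp [Real.zero_rpow hγ.ne'], by simpa using hl⟩

theorem one_sub_mul_rpow_neg_eq_iff {l γ Λ : ℝ} (hΛ : 0 < Λ) :
    (1 - Λ) * Λ ^ (-γ) = l ↔ l * Λ ^ γ + Λ = 1 := by
  rw [Real.rpow_neg hΛ.le, ← div_eq_mul_inv, div_eq_iff (Real.rpow_pos_of_pos hΛ γ).ne']
  constructor <;> intro h <;> linarith

theorem mainTheorem1 (f g x : ℝ → ℝ) (ξ β θ : ℝ) (L : EReal)
    (hf_sign : ∀ u : ℝ, u ≠ 0 → 0 < u * f u) (hf_zero : f 0 = 0)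
    (hf_lip : LocallyLipschitz f)
    (hf_cont : Continuous f) (hg_cont : ContinuousOn g (Ici 0))
    (hg_pos : ∀ t : ℝ, 0 < t → 0 < g t) (hξ : 0 < ξ)
    (hβ : 1 < β) (hf_rv : RegVaryingAtZero f β)
    (hθ : 0 < θ) (hg_rv : RegVaryingAtTop g (-θ))
    (hx : IsPerturbedSolution f g ξ x)
    (hx_lim : Tendsto x atTop (𝓝 0))
    (hL_nonneg : 0 ≤ L)
    (hL : Tendsto (fun t : ℝ => ((g t / f (odeFInv f t) : ℝ) : EReal)) atTop (𝓝 L)) :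
    (L = 0 → Tendsto (fun t => odeF f (x t) / t) atTop (𝓝 1)) ∧
    (∀ l : ℝ, 0 < l → L = (l : EReal) →
      ∃ Λ : ℝ, (Λ ∈ Ioo (0 : ℝ) 1 ∧ (1 - Λ) * Λ ^ (-(β / (β - 1))) = l) ∧
        (∀ Λ' ∈ Ioo (0 : ℝ) 1, (1 - Λ') * Λ' ^ (-(β / (β - 1))) = l → Λ' = Λ) ∧
        Tendsto (fun t => odeF f (x t) / t) atTop (𝓝 Λ)) ∧
    (L = ⊤ → Tendsto (fun t => f (x t) / g t) atTop (𝓝 1)) := by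
  have hpos : ∀ u, 0 < u → 0 < f u := fun u hu => pos_of_mul_pos_right (hf_sign u hu.ne') hu.le
  have hneg : ∀ u, u ≤ 0 → f u ≤ 0 := by
    intro u hu
    rcases hu.eq_or_lt with rfl | hu
    · exact hf_zero.le
    · exact (neg_of_mul_pos_right (hf_sign u hu.ne) hu.le).le
  have hxpos : ∀ t, 0 ≤ t → 0 < x t := fun t ht => hx.pos hξ hneg hg_pos ht
  have htop := tendsto_odeF_atTop hf_cont hpos hf_lip hf_zero
  set γ := β / (β - 1) with hγdef
  have hγ : 0 < γ := div_pos (by linarith) (by linarith)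
  set φ : ℝ → ℝ := fun t => f (odeFInv f t) with hφdef
  have hφz : ∀ t, 0 ≤ t → φ (odeF f (x t)) = f (x t) := fun t ht => by
    simp only [hφdef]
    rw [odeFInv_odeF hf_cont hpos (hxpos t ht)]
  have hφ : ∀ᶠ t in atTop, 0 < φ t := by
    filter_upwards [eventually_ge_atTop 0] with t ht
    exact hpos _ (odeFInv_spec hf_cont hpos htop ht).1
  have hz : ∀ᶠ t in atTop,
      HasDerivAt (fun t => odeF f (x t)) (1 - g t / φ (odeF f (x t))) t := by
    filter_upwards [eventually_gt_atTop 0] with t ht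
    have hxt := hxpos t ht.le
    have hfx := (hpos _ hxt).ne'
    rw [hφz t ht.le]
    have heq : 1 - g t / f (x t) = -(1 / f (x t)) * (-f (x t) + g t) := by
      field_simp
      ring
    rw [heq]
    exact (hasDerivAt_odeF hf_cont hpos hxt).comp t (hx.hasDerivAt t ht)
  have hz_top : Tendsto (fun t => odeF f (x t)) atTop atTop :=
    htop.comp (tendsto_nhdsWithin_iff.2 ⟨hx_lim,
      (eventually_ge_atTop 0).mono fun t ht => hxpos t ht⟩)
  have hA : ∀ a K : ℝ, 0 < a → a ^ (-γ) < K → ∀ᶠ t in atTop, ∀ s ≥ a * t, φ s ≤ K * φ t :=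
    fun a K ha hK => hf_rv.eventually_forall_comp_odeFInv_le hβ hf_cont hpos htop ha hK
  have hg_ev : ∀ᶠ t in atTop, 0 < g t := (eventually_gt_atTop 0).mono hg_pos
  refine ⟨?_, ?_, ?_⟩
  · rintro rfl
    exact tendsto_div_of_tendsto_div hγ hφ hz hz_top hA hg_ev le_rfl
      (EReal.tendsto_coe.1 hL) one_pos (by simp)
  · rintro l hl rfl
    obtain ⟨Λ, hΛ, hΛl⟩ := exists_mem_Ioo_mul_rpow_add_eq_one hl hγ
    refine ⟨Λ, ⟨hΛ, (one_sub_mul_rpow_neg_eq_iff hΛ.1).2 hΛl⟩, fun Λ' hΛ' h => ?_, ?_⟩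
    · exact (strictMonoOn_mul_rpow_add_id hl.le hγ).injOn hΛ'.1.le hΛ.1.le
        (((one_sub_mul_rpow_neg_eq_iff hΛ'.1).1 h).trans hΛl.symm)
    · exact tendsto_div_of_tendsto_div hγ hφ hz hz_top hA hg_ev hl.le
        (EReal.tendsto_coe.1 hL) hΛ.1 (by linarith)
  · rintro rfl
    have := tendsto_comp_div_of_tendsto_div_atTop hφ hz hz_top hA hg_ev
      (fun ε hε => hg_rv.exists_forall_abs_log_sub_lt
        (hg_cont.mono Ioi_subset_Ici_self) hg_pos hε)
      (EReal.tendsto_coe_nhds_top_iff.1 hL)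
    refine this.congr' ?_
    filter_upwards [eventually_ge_atTop 0] with t ht
    rw [hφz t ht]
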